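/- Let $K$ be a field and $h\ge 2$ an integer. In $K[x_0,x_1,x_2,x_3,x_4]$ consider the binomials $$w=x_2x_3-x_1x_4,$$ $$g_i=x_1^{i}x_3^{h-i+1}-x_2^{i+1}x_4^{h-i}\quad(0\le i\le h-1),\qquad g_h=x_2^{h+1}-x_1^{h}x_3,$$ $$q_j=x_1^{j+1}x_2^{h-j}-x_3^{j}x_4^{h-j}x_0\quad(0\le j\le h).$$ Put $n_0=0$, $n_1=h(h+1)$, $n_2=h(h+1)+1$, $n_3=(h+1)^2$, $n_4=(h+1)^2+1$. Let $\overline{\mathfrak I_h}$ be the defining ideal of the projective closure of Arslan's curve $\mathfrak A_h=C(n_1,n_2,n_3,n_4)=\{(b^{n_1},b^{n_2},b^{n_3},b^{n_4})\}$, that is, the kernel of the $K$-algebra homomorphism $$K[x_0,\dots,x_4]\to K[s,t],\qquad x_i\mapsto t^{n_i}s^{n_4-n_i}\quad(0\le i\le 4).$$ Then the set $$\mathfrak U_h=\{w\}\cup\{g_i\mid 0\le i\le h\}\cup\{q_j\mid 0\le j\le h\}$$ is a Gröbner basis of $\overline{\mathfrak I_h}$ with respect to the degree reverse lexicographic monomial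 order with $x_1>x_2>x_3>x_4>x_0$; that is, $\mathfrak U_h$ is a finite subset of $\overline{\mathfrak I_h}$ and the leading terms of its elements generate the ideal generated by the leading terms of all elements of $\overline{\mathfrak I_h}$. -/

import Mathlib

namespace Arslan

/-- A type synonym for the exponents of monomials in the variables `v 0, …, v (n - 1)`, to be
ordered by the degree reverse lexicographic order with `v 0 > v 1 > ⋯ > v (n - 1)`. -/
def DegRevLexSyn {σ : Type*} {n : ℕ} (_v : Fin n ≃ σ) : Type _ := σ →₀ ℕ

noncomputable instance {σ : Type*} {n : ℕ} (v : Fin n ≃ σ) : AddCommMonoid (DegRevLexSyn v) :=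
  inferInstanceAs (AddCommMonoid (σ →₀ ℕ))

/-- The identity, as an additive equivalence onto the type synonym. -/
noncomputable def toDegRevLexSyn {σ : Type*} {n : ℕ} (v : Fin n ≃ σ) :
    (σ →₀ ℕ) ≃+ DegRevLexSyn v where
  toFun a := a
  invFun a := a
  left_inv _ := rfl
  right_inv _ := rfl
  map_add' _ _ := rfl

/-- The sorting key of an exponent: first its total degree; in case of a tie, the exponents listed
from the smallest variable to the largest one, compared lexicographically and reversed. -/
noncomputable def degRevLexKey {σ : Type*} {n : ℕ} (v : Fin n ≃ σ) (a : σ →₀ ℕ) :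
    ℕ ×ₗ (Lex (Fin n → ℕ))ᵒᵈ :=
  toLex (a.degree, OrderDual.toDual (toLex fun j : Fin n => a (v j.rev)))

theorem degRevLexKey_injective {σ : Type*} {n : ℕ} (v : Fin n ≃ σ) :
    Function.Injective (degRevLexKey v) := by
  intro a b hab
  have h2 : (fun j : Fin n => a (v j.rev)) = fun j : Fin n => b (v j.rev) :=
    congrArg (fun p => (ofLex p).2) hab
  refine Finsupp.ext fun i => ?_
  simpa using congrFun h2 (v.symm i).rev

noncomputable instance {σ : Type*} {n : ℕ} (v : Fin n ≃ σ) : LinearOrder (DegRevLexSyn v) :=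
  LinearOrder.lift' (fun a => degRevLexKey v ((toDegRevLexSyn v).symm a))
    ((degRevLexKey_injective v).comp (toDegRevLexSyn v).symm.injective)

theorem toDegRevLexSyn_lt_iff {σ : Type*} {n : ℕ} (v : Fin n ≃ σ) (a b : σ →₀ ℕ) :
    toDegRevLexSyn v a < toDegRevLexSyn v b ↔
      a.degree < b.degree ∨ (a.degree = b.degree ∧
        ∃ i : Fin n, b (v i) < a (v i) ∧ ∀ j, i < j → a (v j) = b (v j)) := by
  change degRevLexKey v a < degRevLexKey v b ↔ _
  rw [Prod.Lex.lt_iff]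
  refine or_congr Iff.rfl (and_congr Iff.rfl ?_)
  change (∃ i : Fin n, (∀ j < i, b (v j.rev) = a (v j.rev)) ∧ b (v i.rev) < a (v i.rev)) ↔ _
  constructor
  · rintro ⟨i, h1, h2⟩
    refine ⟨i.rev, h2, fun j hj => ?_⟩
    have := h1 j.rev (by rw [← Fin.rev_lt_rev]; simpa using hj)
    simpa using this.symm
  · rintro ⟨i, h1, h2⟩
    refine ⟨i.rev, fun j hj => ?_, by simpa using h1⟩
    exact (h2 j.rev (by rw [← Fin.rev_lt_rev]; simpa using hj)).symm

instance {σ : Type*} {n : ℕ} (v : Fin n ≃ σ) : IsOrderedAddMonoid (DegRevLexSyn v) where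
  add_le_add_left a b hab c := by
    obtain ⟨a, rfl⟩ := (toDegRevLexSyn v).surjective a
    obtain ⟨b, rfl⟩ := (toDegRevLexSyn v).surjective b
    obtain ⟨c, rfl⟩ := (toDegRevLexSyn v).surjective c
    rcases eq_or_lt_of_le hab with heq | hlt
    · rw [heq]
    · rw [← map_add, ← map_add]
      refine le_of_lt ?_
      rw [toDegRevLexSyn_lt_iff] at hlt ⊢
      simpa [map_add] using hlt

theorem toDegRevLexSyn_monotone {σ : Type*} {n : ℕ} (v : Fin n ≃ σ) :
    Monotone (toDegRevLexSyn v) := by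
  intro a b hab
  obtain ⟨c, rfl⟩ := exists_add_of_le hab
  rcases eq_or_ne c 0 with rfl | hc
  · rw [add_zero]
  · refine le_of_lt ((toDegRevLexSyn_lt_iff v a (a + c)).2 (Or.inl ?_))
    rw [map_add]
    have : c.degree ≠ 0 := by rwa [Ne, Finsupp.degree_eq_zero_iff]
    omega

instance {σ : Type*} {n : ℕ} (v : Fin n ≃ σ) : WellFoundedLT (DegRevLexSyn v) := by
  have : Finite σ := Finite.of_equiv _ v
  rw [← wellQuasiOrderedLE_iff_wellFoundedLT]
  refine ⟨fun f => ?_⟩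
  obtain ⟨i, j, hij, h⟩ :=
    wellQuasiOrdered_le (α := σ →₀ ℕ) fun k => (toDegRevLexSyn v).symm (f k)
  exact ⟨i, j, hij, toDegRevLexSyn_monotone v h⟩

/-- The degree reverse lexicographic monomial order with `v 0 > v 1 > ⋯ > v (n - 1)`. -/
noncomputable def degRevLex {σ : Type*} {n : ℕ} (v : Fin n ≃ σ) : MonomialOrder σ where
  syn := DegRevLexSyn v
  toSyn := toDegRevLexSyn v
  toSyn_monotone := toDegRevLexSyn_monotone v

open scoped MonomialOrder in
/-- `x ^ a < x ^ b` iff `a` has smaller total degree, or the total degrees agree and, at the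
smallest variable where the exponents differ, `a` has the larger exponent. -/
theorem degRevLex_lt_iff {σ : Type*} {n : ℕ} (v : Fin n ≃ σ) (a b : σ →₀ ℕ) :
    a ≺[degRevLex v] b ↔
      a.degree < b.degree ∨ (a.degree = b.degree ∧
        ∃ i : Fin n, b (v i) < a (v i) ∧ ∀ j, i < j → a (v j) = b (v j)) :=
  toDegRevLexSyn_lt_iff v a b

/-- `G` is a (finite) Gröbner basis of the ideal `I` with respect to the monomial order `m`:
`G` is contained in `I`, and the leading terms of the elements of `G` generate the initial ideal
of `I`. -/
def IsGroebnerBasis {σ K : Type*} [Field K] (m : MonomialOrder σ)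
    (G : Set (MvPolynomial σ K)) (I : Ideal (MvPolynomial σ K)) : Prop :=
  G.Finite ∧ G ⊆ (I : Set (MvPolynomial σ K)) ∧
    Ideal.span (m.leadingTerm '' G) = Ideal.span (m.leadingTerm '' (I : Set (MvPolynomial σ K)))

open MvPolynomial in
/-- For exponents `n₁, …, n_r` (with `n_r` the largest one) and `n₀ = 0`, the map
`K[x₀, …, x_r] → K[s, t]`, `xᵢ ↦ t ^ nᵢ * s ^ (n_r - nᵢ)`, where `s = X 0` and `t = X 1`. -/
noncomputable def projParam (K : Type*) [Field K] {r : ℕ} (n : Fin r → ℕ) :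
    MvPolynomial (Fin (r + 1)) K →ₐ[K] MvPolynomial (Fin 2) K :=
  let n' : Fin (r + 1) → ℕ := Fin.cons 0 n
  aeval fun i => X 1 ^ n' i * X 0 ^ (n' (Fin.last r) - n' i)

/-- The defining ideal of the projective closure of the affine monomial curve
`C(n₁, …, n_r) = {(b ^ n₁, …, b ^ n_r)}`. -/
noncomputable def projClosureIdeal (K : Type*) [Field K] {r : ℕ} (n : Fin r → ℕ) :
    Ideal (MvPolynomial (Fin (r + 1)) K) :=
  RingHom.ker (projParam K n)

/-- The exponents of Arslan's curve. -/
def arslanExponents (h : ℕ) : Fin 4 → ℕ :=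
  ![h * (h + 1), h * (h + 1) + 1, (h + 1) ^ 2, (h + 1) ^ 2 + 1]

/-- The variables `x₁, x₂, x₃, x₄, x₀`, in this order, where `xᵢ = X i`. -/
def varOrder : Fin 5 ≃ Fin 5 where
  toFun := ![1, 2, 3, 4, 0]
  invFun := ![4, 0, 1, 2, 3]
  left_inv := by decide
  right_inv := by decide

open MvPolynomial in
/-- The binomial `w`. -/
noncomputable def w (K : Type*) [Field K] : MvPolynomial (Fin 5) K :=
  X 2 * X 3 - X 1 * X 4

open MvPolynomial in
/-- The binomials `g₀, …, g_h`, with a separate sign convention for `g_h`. -/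
noncomputable def g (K : Type*) [Field K] (h i : ℕ) : MvPolynomial (Fin 5) K :=
  if i < h then X 1 ^ i * X 3 ^ (h - i + 1) - X 2 ^ (i + 1) * X 4 ^ (h - i)
  else X 2 ^ (h + 1) - X 1 ^ h * X 3

open MvPolynomial in
/-- The binomials `q₀, …, q_h`. -/
noncomputable def q (K : Type*) [Field K] (h j : ℕ) : MvPolynomial (Fin 5) K :=
  X 1 ^ (j + 1) * X 2 ^ (h - j) - X 3 ^ j * X 4 ^ (h - j) * X 0

/-- The set of all `w`, `gᵢ`, `qⱼ`, `0 ≤ i, j ≤ h`. -/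
noncomputable def basisSet (K : Type*) [Field K] (h : ℕ) : Set (MvPolynomial (Fin 5) K) :=
  {w K} ∪ {f | ∃ i ≤ h, f = g K h i} ∪ {f | ∃ j ≤ h, f = q K h j}

end Arslan

/-! The ideal is the kernel of a monomial map, and the given binomials lie in it. Suppose monomials
divisible by no leading monomial of the family (standard monomials) have distinct images. The image
of the leading monomial of a nonzero kernel element must cancel against that of a smaller monomial,
whose reduction is a still smaller or equal standard one; so the leading monomial cannot itself be
standard (`isGroebnerBasis_ker_of_injOn`). For standard monomials, the `s`-exponent is `((h+1)^2+1)
* a₀ + R` with `R = (h+2)a₁ + (h+1)a₂ + a₃ ≤ (h+1)^2`. Division yields `a₀` and `R`, the base `h+1`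
digits of `R` yield `a₁, a₂, a₃`, and the `t`-exponent yields `a₄` (`injOn_projExponent`). -/

namespace Arslan

open MvPolynomial
open scoped MonomialOrder

/-! ### Gröbner bases of kernels of monomial maps -/

section Criterion

variable {σ τ K : Type*} [Field K] (m : MonomialOrder σ)

theorem degree_monomial_sub_monomial {u v : σ →₀ ℕ} (huv : v ≺[m] u) :
    m.degree (monomial u (1 : K) - monomial v 1) = u := by
  classical
  rw [m.degree_sub_of_lt, m.degree_monomial, if_neg one_ne_zero]
  simpa [m.degree_monomial] using huv

theorem leadingTerm_monomial_sub_monomial {u v : σ →₀ ℕ} (huv : v ≺[m] u) :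
    m.leadingTerm (monomial u (1 : K) - monomial v 1) = monomial u 1 := by
  classical
  have hne : v ≠ u := by rintro rfl; exact lt_irrefl _ huv
  rw [MonomialOrder.leadingTerm, MonomialOrder.leadingCoeff, degree_monomial_sub_monomial m huv]
  simp [coeff_monomial, hne]

/-- Every exponent is bounded below, within its fiber under `E`, by one that is divisible by no
leading exponent of the family `B` of binomials. -/
theorem exists_reduced_le (E : (σ →₀ ℕ) → (τ →₀ ℕ)) (hadd : ∀ a b, E (a + b) = E a + E b)
    (B : Set ((σ →₀ ℕ) × (σ →₀ ℕ))) (hlt : ∀ p ∈ B, p.2 ≺[m] p.1) (hE : ∀ p ∈ B, E p.1 = E p.2)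
    (a : σ →₀ ℕ) : ∃ b, b ≼[m] a ∧ E b = E a ∧ ∀ p ∈ B, ¬ p.1 ≤ b := by
  have key : ∀ x : m.syn, ∃ b, m.toSyn b ≤ x ∧ E b = E (m.toSyn.symm x) ∧ ∀ p ∈ B, ¬ p.1 ≤ b := by
    intro x
    induction x using WellFoundedLT.induction with
    | ind x ih =>
      by_cases hx : ∀ p ∈ B, ¬ p.1 ≤ m.toSyn.symm x
      · exact ⟨m.toSyn.symm x, by simp, rfl, hx⟩
      · push Not at hx
        obtain ⟨p, hp, hle⟩ := hx
        obtain ⟨c, hc⟩ := exists_add_of_le hle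
        have hx : x = m.toSyn p.1 + m.toSyn c := by
          rw [← map_add, ← hc, AddEquiv.apply_symm_apply]
        -- One reduction step: replacing the factor `p.1` by `p.2` lowers the exponent and preserves
        -- its fiber.
        obtain ⟨b, hb, hbE, hbB⟩ := ih (m.toSyn (p.2 + c)) (by
          rw [hx, map_add]
          exact add_lt_add_left (hlt p hp) _)
        refine ⟨b, hb.trans ?_, ?_, hbB⟩
        · rw [hx, map_add]
          exact add_le_add_left (hlt p hp).le _
        · rw [hbE, hc, hadd, AddEquiv.symm_apply_apply, hadd, hE p hp]
  simpa using key (m.toSyn a)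

/-- The leading exponent of a nonzero element of the kernel of a monomial map shares its fiber with
a smaller exponent. -/
theorem exists_lt_degree_of_map_eq_zero (E : (σ →₀ ℕ) → (τ →₀ ℕ))
    (φ : MvPolynomial σ K →ₐ[K] MvPolynomial τ K)
    (hφ : ∀ a, φ (monomial a 1) = monomial (E a) 1) {f : MvPolynomial σ K} (hf : φ f = 0)
    (hf0 : f ≠ 0) : ∃ a, a ≺[m] m.degree f ∧ E a = E (m.degree f) := by
  classical
  by_contra! hno
  have hmap : φ f = ∑ a ∈ f.support, monomial (E a) (coeff a f) := by
    conv_lhs => rw [f.as_sum, map_sum]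
    refine Finset.sum_congr rfl fun a _ => ?_
    rw [← mul_one (coeff a f), ← smul_eq_mul, ← smul_monomial, map_smul, hφ, smul_monomial]
  -- By `hno`, no other monomial of `f` has the same image as the leading one, so its coefficient
  -- survives.
  have hcoeff : coeff (E (m.degree f)) (φ f) = coeff (m.degree f) f := by
    rw [hmap, coeff_sum, Finset.sum_eq_single (m.degree f)]
    · simp
    · intro a ha hne
      rw [coeff_monomial, if_neg]
      refine hno a (lt_of_le_of_ne (m.le_degree ha) fun h => hne (m.toSyn.injective h))
    · intro h
      simpa using h
  rw [hf, coeff_zero] at hcoeff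
  exact m.leadingCoeff_ne_zero_iff.2 hf0 hcoeff.symm

/-- A family of binomials in the kernel of a monomial map is a Gröbner basis of the kernel if
distinct monomials divisible by none of its leading monomials have distinct images. -/
theorem isGroebnerBasis_ker_of_injOn (E : (σ →₀ ℕ) → (τ →₀ ℕ))
    (hadd : ∀ a b, E (a + b) = E a + E b) (φ : MvPolynomial σ K →ₐ[K] MvPolynomial τ K)
    (hφ : ∀ a, φ (monomial a 1) = monomial (E a) 1) (B : Set ((σ →₀ ℕ) × (σ →₀ ℕ)))
    (hfin : B.Finite) (hlt : ∀ p ∈ B, p.2 ≺[m] p.1) (hE : ∀ p ∈ B, E p.1 = E p.2)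
    (hinj : Set.InjOn E {a | ∀ p ∈ B, ¬ p.1 ≤ a}) :
    IsGroebnerBasis m ((fun p => monomial p.1 (1 : K) - monomial p.2 1) '' B)
      (RingHom.ker φ) := by
  have hsub : ((fun p => monomial p.1 (1 : K) - monomial p.2 1) '' B) ⊆
      (RingHom.ker φ : Set (MvPolynomial σ K)) := by
    rintro _ ⟨p, hp, rfl⟩
    simp [RingHom.mem_ker, hφ, hE p hp]
  refine ⟨hfin.image _, hsub, le_antisymm (Ideal.span_mono (Set.image_mono hsub)) ?_⟩
  rw [Ideal.span_le]
  rintro _ ⟨f, hf, rfl⟩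
  by_cases hf0 : f = 0
  · simp [hf0]
  have hred : ∃ p ∈ B, p.1 ≤ m.degree f := by
    by_contra! hno
    obtain ⟨a, ha, haE⟩ := exists_lt_degree_of_map_eq_zero m E φ hφ hf hf0
    obtain ⟨b, hb, hbE, hbB⟩ := exists_reduced_le m E hadd B hlt hE a
    have hbd := hinj hbB hno (hbE.trans haE)
    rw [hbd] at hb
    exact absurd ha (not_lt.2 hb)
  obtain ⟨p, hp, hle⟩ := hred
  obtain ⟨c, hc⟩ := exists_add_of_le hle
  have hterm : m.leadingTerm f = monomial c (m.leadingCoeff f) *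
      m.leadingTerm (monomial p.1 (1 : K) - monomial p.2 1) := by
    rw [leadingTerm_monomial_sub_monomial m (hlt p hp), monomial_mul, mul_one, add_comm c, ← hc]
    rfl
  rw [hterm]
  exact Ideal.mul_mem_left _ _ (Ideal.subset_span ⟨_, ⟨p, hp, rfl⟩, rfl⟩)

end Criterion

/-! ### The parametrization on exponents -/

/-- The exponents of the image of a monomial under `projParam`. -/
noncomputable def projExponent {r : ℕ} (n : Fin r → ℕ) (a : Fin (r + 1) →₀ ℕ) : Fin 2 →₀ ℕ :=
  let n' : Fin (r + 1) → ℕ := Fin.cons 0 n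
  Finsupp.single 1 (∑ i, n' i * a i) + Finsupp.single 0 (∑ i, (n' (Fin.last r) - n' i) * a i)

theorem projExponent_add {r : ℕ} (n : Fin r → ℕ) (a b : Fin (r + 1) →₀ ℕ) :
    projExponent n (a + b) = projExponent n a + projExponent n b := by
  simp only [projExponent, Finsupp.add_apply, mul_add, Finset.sum_add_distrib, Finsupp.single_add]
  abel

theorem projParam_monomial (K : Type*) [Field K] {r : ℕ} (n : Fin r → ℕ)
    (a : Fin (r + 1) →₀ ℕ) :
    projParam K n (monomial a 1) = monomial (projExponent n a) 1 := by
  have hmon (j : Fin 2) (k : ℕ) : monomial (Finsupp.single j k) (1 : K) = X j ^ k :=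
    (X_pow_eq_monomial).symm
  simp only [projParam, aeval_monomial, map_one, one_mul, projExponent]
  rw [Finsupp.prod_fintype _ _ fun _ => pow_zero _, ← one_mul (1 : K), ← monomial_mul, hmon, hmon,
    ← Finset.prod_pow_eq_pow_sum, ← Finset.prod_pow_eq_pow_sum, ← Finset.prod_mul_distrib]
  simp only [mul_pow, pow_mul]

theorem projExponent_arslanExponents_eq_iff (h : ℕ) (a b : Fin 5 →₀ ℕ) :
    projExponent (arslanExponents h) a = projExponent (arslanExponents h) b ↔
      (h * (h + 1) * a 1 + (h * (h + 1) + 1) * a 2 + (h + 1) ^ 2 * a 3 + ((h + 1) ^ 2 + 1) * a 4 =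
        h * (h + 1) * b 1 + (h * (h + 1) + 1) * b 2 + (h + 1) ^ 2 * b 3 +
          ((h + 1) ^ 2 + 1) * b 4) ∧
      (((h + 1) ^ 2 + 1) * a 0 + (h + 2) * a 1 + (h + 1) * a 2 + a 3 =
        ((h + 1) ^ 2 + 1) * b 0 + (h + 2) * b 1 + (h + 1) * b 2 + b 3) := by
  have h1 : (h + 1) ^ 2 + 1 - h * (h + 1) = h + 2 := by
    rw [Nat.sub_eq_iff_eq_add (by nlinarith)]; ring
  have h2 : (h + 1) ^ 2 + 1 - (h * (h + 1) + 1) = h + 1 := by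
    rw [Nat.sub_eq_iff_eq_add (by nlinarith)]; ring
  have h3 : (h + 1) ^ 2 + 1 - (h + 1) ^ 2 = 1 := by omega
  have hlast (x y z t u : ℕ) : (Fin.cons x ![y, z, t, u] : Fin 5 → ℕ) (Fin.last 4) = u := rfl
  have hc0 (x y z t u : ℕ) : (Fin.cons x ![y, z, t, u] : Fin 5 → ℕ) 0 = x := rfl
  have hc1 (x y z t u : ℕ) : (Fin.cons x ![y, z, t, u] : Fin 5 → ℕ) 1 = y := rfl
  have hc2 (x y z t u : ℕ) : (Fin.cons x ![y, z, t, u] : Fin 5 → ℕ) 2 = z := rfl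
  have hc3 (x y z t u : ℕ) : (Fin.cons x ![y, z, t, u] : Fin 5 → ℕ) 3 = t := rfl
  have hc4 (x y z t u : ℕ) : (Fin.cons x ![y, z, t, u] : Fin 5 → ℕ) 4 = u := rfl
  have hsum (f : Fin (4 + 1) → ℕ) : ∑ i, f i = f 0 + f 1 + f 2 + f 3 + f 4 := Fin.sum_univ_five f
  simp only [projExponent, arslanExponents, hsum, hlast, hc0, hc1, hc2, hc3, hc4, h1,
    h2, h3, Nat.sub_self, Nat.sub_zero, zero_mul, one_mul, zero_add, add_zero]
  constructor
  · intro heq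
    have e1 := DFunLike.congr_fun heq 1
    have e0 := DFunLike.congr_fun heq 0
    simpa using And.intro e1 e0
  · rintro ⟨e1, e0⟩
    rw [e1, e0]

/-! ### The binomials and their leading monomials -/

/-- The exponent of the monomial `x₀ ^ e * x₁ ^ a * x₂ ^ b * x₃ ^ c * x₄ ^ d`. -/
noncomputable def expo (e a b c d : ℕ) : Fin 5 →₀ ℕ :=
  Finsupp.equivFunOnFinite.symm ![e, a, b, c, d]

section expo

variable (e a b c d : ℕ)

@[simp] theorem expo_zero : expo e a b c d 0 = e := rfl
@[simp] theorem expo_one : expo e a b c d 1 = a := rfl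
@[simp] theorem expo_two : expo e a b c d 2 = b := rfl
@[simp] theorem expo_three : expo e a b c d 3 = c := rfl
@[simp] theorem expo_four : expo e a b c d 4 = d := rfl

theorem expo_le_iff (f : Fin 5 →₀ ℕ) :
    expo e a b c d ≤ f ↔ e ≤ f 0 ∧ a ≤ f 1 ∧ b ≤ f 2 ∧ c ≤ f 3 ∧ d ≤ f 4 := by
  rw [Finsupp.le_def]
  simp [Fin.forall_fin_succ]

theorem monomial_expo (K : Type*) [Field K] :
    monomial (expo e a b c d) (1 : K) = X 0 ^ e * X 1 ^ a * X 2 ^ b * X 3 ^ c * X 4 ^ d := by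
  rw [monomial_eq, Finsupp.prod_fintype _ _ fun _ => pow_zero _, Fin.prod_univ_five]
  simp

end expo

/-- Comparing `x₀`, `x₄`, `x₃` in turn suffices for the family: `x₀` decides `qⱼ`, `x₄` decides `w`
and `gᵢ` for `i < h`, `x₃` decides `g_h`. -/
theorem degRevLex_varOrder_lt_of_degree_eq {a b : Fin 5 →₀ ℕ}
    (hdeg : a 0 + a 1 + a 2 + a 3 + a 4 = b 0 + b 1 + b 2 + b 3 + b 4)
    (h : b 0 < a 0 ∨ a 0 = b 0 ∧ (b 4 < a 4 ∨ a 4 = b 4 ∧ b 3 < a 3)) :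
    a ≺[degRevLex varOrder] b := by
  have v2 : varOrder 2 = 3 := rfl
  have v3 : varOrder 3 = 4 := rfl
  have v4 : varOrder 4 = 0 := rfl
  rw [degRevLex_lt_iff]
  refine Or.inr ⟨by simpa [Finsupp.degree_eq_sum, Fin.sum_univ_five] using hdeg, ?_⟩
  rcases h with h | ⟨h0, h | ⟨h4, h⟩⟩
  · exact ⟨4, h, fun j hj => by omega⟩
  · refine ⟨3, h, fun j hj => ?_⟩
    obtain rfl : j = 4 := by omega
    exact h0
  · refine ⟨2, h, fun j hj => ?_⟩
    obtain rfl | rfl : j = 3 ∨ j = 4 := by omega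
    · exact h4
    · exact h0

/-- The pairs of exponents of the leading and trailing monomials of `w`, `gᵢ`, `qⱼ`. -/
def basisExponents (h : ℕ) : Set ((Fin 5 →₀ ℕ) × (Fin 5 →₀ ℕ)) :=
  {(expo 0 0 1 1 0, expo 0 1 0 0 1), (expo 0 0 (h + 1) 0 0, expo 0 h 0 1 0)} ∪
    (fun i => (expo 0 i 0 (h - i + 1) 0, expo 0 0 (i + 1) 0 (h - i))) '' Set.Iio h ∪
    (fun j => (expo 0 (j + 1) (h - j) 0 0, expo 1 0 0 j (h - j))) '' Set.Iic h

theorem forall_mem_basisExponents {h : ℕ} {P : (Fin 5 →₀ ℕ) × (Fin 5 →₀ ℕ) → Prop} :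
    (∀ p ∈ basisExponents h, P p) ↔
      P (expo 0 0 1 1 0, expo 0 1 0 0 1) ∧ P (expo 0 0 (h + 1) 0 0, expo 0 h 0 1 0) ∧
      (∀ i < h, P (expo 0 i 0 (h - i + 1) 0, expo 0 0 (i + 1) 0 (h - i))) ∧
      (∀ j ≤ h, P (expo 0 (j + 1) (h - j) 0 0, expo 1 0 0 j (h - j))) := by
  simp only [basisExponents, Set.mem_union, or_imp, forall_and, Set.forall_mem_image, Set.mem_Iio,
    Set.mem_Iic, Set.mem_insert_iff, Set.mem_singleton_iff, forall_eq, and_assoc]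

theorem finite_basisExponents (h : ℕ) : (basisExponents h).Finite :=
  ((Set.toFinite _).union ((Set.finite_Iio h).image _)).union ((Set.finite_Iic h).image _)

theorem image_basisExponents (K : Type*) [Field K] (h : ℕ) :
    (fun p => monomial p.1 (1 : K) - monomial p.2 1) '' basisExponents h = basisSet K h := by
  simp only [basisExponents, Set.image_union, Set.image_pair, Set.image_image, monomial_expo,
    pow_zero, one_mul, mul_one, pow_one]
  ext f
  simp only [basisSet, Set.mem_union, Set.mem_insert_iff, Set.mem_singleton_iff, Set.mem_image,
    Set.mem_Iio, Set.mem_Iic, Set.mem_ofPred_eq]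
  constructor
  · rintro (((rfl | rfl) | ⟨i, hi, rfl⟩) | ⟨j, hj, rfl⟩)
    · exact Or.inl (Or.inl rfl)
    · exact Or.inl (Or.inr ⟨h, le_rfl, by simp [g]⟩)
    · exact Or.inl (Or.inr ⟨i, hi.le, by simp [g, hi]⟩)
    · exact Or.inr ⟨j, hj, by rw [q]; ring⟩
  · rintro ((rfl | ⟨i, hi, rfl⟩) | ⟨j, hj, rfl⟩)
    · exact Or.inl (Or.inl (Or.inl rfl))
    · rcases hi.eq_or_lt with rfl | hi
      · exact Or.inl (Or.inl (Or.inr (by simp [g])))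
      · exact Or.inl (Or.inr ⟨i, hi, by simp [g, hi]⟩)
    · exact Or.inr ⟨j, hj, by rw [q]; ring⟩

theorem snd_lt_fst_of_mem_basisExponents {h : ℕ} :
    ∀ p ∈ basisExponents h, p.2 ≺[degRevLex varOrder] p.1 := by
  rw [forall_mem_basisExponents]
  refine ⟨?_, ?_, fun i hi => ?_, fun j hj => ?_⟩ <;>
    refine degRevLex_varOrder_lt_of_degree_eq ?_ ?_ <;> simp <;> omega

theorem projExponent_eq_of_mem_basisExponents {h : ℕ} :
    ∀ p ∈ basisExponents h,
      projExponent (arslanExponents h) p.1 = projExponent (arslanExponents h) p.2 := by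
  simp only [forall_mem_basisExponents, projExponent_arslanExponents_eq_iff, expo_zero, expo_one,
    expo_two, expo_three, expo_four]
  refine ⟨⟨by ring, by ring⟩, ⟨by ring, by ring⟩, fun i hi => ?_, fun j hj => ?_⟩
  -- Writing `h = i + k` removes the truncated subtraction.
  · obtain ⟨k, rfl⟩ := Nat.exists_eq_add_of_le hi.le
    rw [Nat.add_sub_cancel_left]
    constructor <;> ring
  · obtain ⟨k, rfl⟩ := Nat.exists_eq_add_of_le hj
    rw [Nat.add_sub_cancel_left]
    constructor <;> ring

/-! ### Standard monomials and injectivity -/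

/-- The exponents of the monomials divisible by no leading monomial of `w`, `gᵢ`, `qⱼ`. -/
theorem reduced_cases {h : ℕ} (hh : 0 < h) {f : Fin 5 →₀ ℕ} (hf : ∀ p ∈ basisExponents h, ¬ p.1 ≤ f) :
    f 3 = 0 ∧ f 1 + f 2 ≤ h ∨ f 2 = 0 ∧ 1 ≤ f 3 ∧ f 1 + f 3 ≤ h ∨
      f 2 = 0 ∧ f 3 = 1 ∧ f 1 = h := by
  simp only [forall_mem_basisExponents, expo_le_iff, Nat.zero_le, true_and, and_true] at hf
  obtain ⟨hw, hgh, hg, hq⟩ := hf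
  -- These instances bound `x₃`, `x₁x₃`, `x₁` and `x₁x₂`. The leading monomial of `g_h` is not `x₁^h
  -- x₃`, which therefore remains as the exceptional third case.
  have hg0 := hg 0
  have hg1 := hg (h + 1 - f 3)
  have hq0 := hq h
  have hq1 := hq (f 1 - 1)
  omega

theorem eq_of_mul_add_eq_mul_add {n x y r s : ℕ} (hr : r < n) (hs : s < n)
    (h : n * x + r = n * y + s) : x = y ∧ r = s := by
  have hn : 0 < n := by omega
  have hx := congrArg (· / n) h
  have hm := congrArg (· % n) h
  simpa [Nat.mul_add_div hn, Nat.div_eq_of_lt, Nat.mod_eq_of_lt, hr, hs] using And.intro hx hm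

/-- Since `R = (h+1)(a+b) + (a+c)`, the digits are `u = a + b` and `v = a + c`; as `b` or `c`
vanishes, `v ≤ u` tells which. For `x₁^h x₃` the second digit overflows: `R = (h+1)^2`, so `u = h +
1` and `v = 0`. -/
theorem exists_digits_of_reduced {h a b c : ℕ}
    (H : c = 0 ∧ a + b ≤ h ∨ b = 0 ∧ 1 ≤ c ∧ a + c ≤ h ∨ b = 0 ∧ c = 1 ∧ a = h) :
    ∃ u v, (h + 2) * a + (h + 1) * b + c = (h + 1) * u + v ∧ v < h + 1 ∧
      (u ≤ h ∧ (v ≤ u ∧ a = v ∧ b = u - v ∧ c = 0 ∨ u < v ∧ a = u ∧ b = 0 ∧ c = v - u) ∨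
        u = h + 1 ∧ v = 0 ∧ a = h ∧ b = 0 ∧ c = 1) := by
  rcases H with ⟨rfl, hab⟩ | ⟨rfl, hc, hac⟩ | ⟨rfl, rfl, rfl⟩
  · exact ⟨a + b, a, by ring, by omega, by omega⟩
  · exact ⟨a, a + c, by ring, by omega, by omega⟩
  · exact ⟨a + 1, 0, by ring, by omega, by omega⟩

theorem injOn_projExponent {h : ℕ} (hh : 0 < h) :
    Set.InjOn (projExponent (arslanExponents h)) {a | ∀ p ∈ basisExponents h, ¬ p.1 ≤ a} := by
  intro f hf f' hf' heq
  rw [projExponent_arslanExponents_eq_iff] at heq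
  obtain ⟨e1, e0⟩ := heq
  obtain ⟨u, v, hR, hv, hcase⟩ := exists_digits_of_reduced (reduced_cases hh hf)
  obtain ⟨u', v', hR', hv', hcase'⟩ := exists_digits_of_reduced (reduced_cases hh hf')
  have bound {u v : ℕ} (h1 : v < h + 1) (h2 : u ≤ h ∨ u = h + 1 ∧ v = 0) :
      (h + 1) * u + v < (h + 1) ^ 2 + 1 := by
    rcases h2 with h2 | ⟨rfl, rfl⟩
    · have := Nat.mul_le_mul_left (h + 1) h2
      nlinarith
    · nlinarith
  obtain ⟨h0, hRR⟩ := eq_of_mul_add_eq_mul_add (bound hv (by omega)) (bound hv' (by omega))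
    (show ((h + 1) ^ 2 + 1) * f 0 + ((h + 1) * u + v) =
      ((h + 1) ^ 2 + 1) * f' 0 + ((h + 1) * u' + v') by rw [← hR, ← hR']; linarith)
  obtain ⟨rfl, rfl⟩ := eq_of_mul_add_eq_mul_add hv hv' hRR
  have h123 : f 1 = f' 1 ∧ f 2 = f' 2 ∧ f 3 = f' 3 := by omega
  obtain ⟨h1, h2, h3⟩ := h123
  rw [h1, h2, h3, Nat.add_left_cancel_iff] at e1
  -- Only the `x₄` term is left in the `t`-exponent, with a positive coefficient.
  have h4 : f 4 = f' 4 := Nat.eq_of_mul_eq_mul_left (by positivity) e1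
  ext i
  fin_cases i <;> assumption

end Arslan

theorem mainTheorem9 (K : Type*) [Field K] (h : ℕ) (hh : 2 ≤ h) :
    Arslan.IsGroebnerBasis (Arslan.degRevLex Arslan.varOrder) (Arslan.basisSet K h)
      (Arslan.projClosureIdeal K (Arslan.arslanExponents h)) := by
  rw [← Arslan.image_basisExponents]
  exact Arslan.isGroebnerBasis_ker_of_injOn _ _ (Arslan.projExponent_add _) _
    (Arslan.projParam_monomial K _) _ (Arslan.finite_basisExponents h)
    Arslan.snd_lt_fst_of_mem_basisExponents Arslan.projExponent_eq_of_mem_basisExponents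
    (Arslan.injOn_projExponent (by omega))
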